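/- Let $f_1:\mathbb{R}^{d_x}\to\mathbb{R}$, $g_1:\mathbb{R}^{d_y}\to\mathbb{R}$, $f_2:\mathbb{R}^{d_x}\to\mathbb{R}\cup\{+\infty\}$, $g_2:\mathbb{R}^{d_y}\to\mathbb{R}\cup\{+\infty\}$, $B\in\mathbb{R}^{d_y\times d_x}$, and consider $$\min_{x\in\mathbb{R}^{d_x}}\max_{y\in\mathbb{R}^{d_y}}\ \mathcal{L}(x,y)=f_1(x)+f_2(x)+y^\top Bx-g_1(y)-g_2(y).$$ Assume that $f_1$ is $\mu_x$-strongly convex and $L_x$-smooth (differentiable with $L_x$-Lipschitz gradient) with $L_x\ge\mu_x>0$, that $g_1$ is convex and $L_y$-smooth with $L_y\ge 0$, and that $f_2,g_2$ are proper, convex and lower semicontinuous. Let $(x^*,y^*)$ be a solution, i.e. a saddle point of $\mathcal{L}$. Let $\sigma_{\max}(B)$ be the largest singular value of $B$, and assume that $\varphi(y)=g_1(y)+(f_1+f_2)^*(-B^\top y)$, where $(f_1+f_2)^*$ is the Fenchel conjugate, is $\mu_\varphi$-strongly convex with $\mu_\varphi>0$. Put $$L_\varphi=L_y+\frac{\sigma_{\max}^2(B)}{\mu_x},\qquad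 \kappa_\varphi=\frac{L_\varphi}{\mu_\varphi}=\frac{\sigma_{\max}^2(B)+\mu_xL_y}{\mu_x\mu_\varphi}.$$ Let $(x^k),(y^k),(z^k)$ be generated by iDAPG: $y^0$ is arbitrary, $z^0=y^0$, and for all $k\ge 0$, $x^{k+1}$ is an inexact solution of $\min_x f_1(x)+f_2(x)+\langle B^\top z^k,x\rangle$ and $$y^{k+1}=\mathrm{prox}_{\frac{1}{L_\varphi}g_2}\Big(z^k-\tfrac{1}{L_\varphi}\big(\nabla g_1(z^k)-Bx^{k+1}\big)\Big),\qquad z^{k+1}=y^{k+1}+\frac{\sqrt{\kappa_\varphi}-1}{\sqrt{\kappa_\varphi}+1}\,(y^{k+1}-y^k),$$ where $\mathrm{prox}_{\alpha g}(v)=\arg\min_u g(u)+\frac{1}{2\alpha}\|u-v\|^2$. Suppose that for all $k\ge0$ $$\|x^{k+1}-x^*(z^k)\|^2\le\frac{\varepsilon_{k+1}^2}{\sigma_{\max}^2(B)},\qquad x^*(z)=\arg\min_x f_1(x)+f_2(x)+z^\top Bx$$ (if $B=0$, the right-hand side is read as $0$), and that for some $\theta\in(0,1)$, $\varepsilon_{k+1}^2=\theta\,\varepsilon_k^2$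 for all $k\ge1$. Then, as $k\to\infty$, both $\|x^{k+1}-x^*\|^2$ and $\|y^k-y^*\|^2$ are 1. $O\Big(\max\big(1-\tfrac{1}{\sqrt{\kappa_\varphi}},\,\theta\big)^k\Big)$ if $\theta\ne 1-\tfrac{1}{\sqrt{\kappa_\varphi}}$; 2. $O\Big(k^2\big(1-\tfrac{1}{\sqrt{\kappa_\varphi}}\big)^k\Big)$ if $\theta=1-\tfrac{1}{\sqrt{\kappa_\varphi}}$. -/

import Mathlib

open Filter Asymptotics

noncomputable section

section ConvexAnalysis

variable {E : Type*} [NormedAddCommGroup E] [InnerProductSpace ℝ E]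

/-- An extended-real-valued function is proper: it never takes the value `-∞` and is finite
somewhere. -/
def IsProperFun (f : E → EReal) : Prop :=
  (∀ x, f x ≠ ⊥) ∧ ∃ x, f x ≠ ⊤

/-- `μ`-strong convexity (with modulus `μ / 2 * ‖x - y‖ ^ 2`) of an extended-real-valued
function that does not take the value `-∞`. It extends Mathlib's `StrongConvexOn Set.univ μ`. -/
def EStrongConvex (μ : ℝ) (f : E → EReal) : Prop :=
  ∀ ⦃x y : E⦄ ⦃a b : ℝ⦄, 0 < a → 0 < b → a + b = 1 →
    f (a • x + b • y) + ((a * b * (μ / 2 * ‖x - y‖ ^ 2) : ℝ) : EReal) ≤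
      (a : EReal) * f x + (b : EReal) * f y

/-- Convexity of an extended-real-valued function that does not take the value `-∞`. -/
def EConvex (f : E → EReal) : Prop :=
  ∀ ⦃x y : E⦄ ⦃a b : ℝ⦄, 0 < a → 0 < b → a + b = 1 →
    f (a • x + b • y) ≤ (a : EReal) * f x + (b : EReal) * f y

/-- `L`-smoothness: `f` is differentiable everywhere with `L`-Lipschitz gradient. -/
def IsLSmooth [CompleteSpace E] (L : ℝ) (f : E → ℝ) : Prop :=
  Differentiable ℝ f ∧ ∀ x y, ‖gradient f x - gradient f y‖ ≤ L * ‖x - y‖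

/-- The Fenchel conjugate `f^*(y) = sup_x (⟨y, x⟩ - f x)`. -/
def fenchelConj (f : E → EReal) (y : E) : EReal :=
  ⨆ x : E, ((inner ℝ y x : ℝ) : EReal) - f x

/-- `p = prox_{α f}(v)`, i.e. `p` minimizes `u ↦ f u + ‖u - v‖ ^ 2 / (2 α)`. -/
def IsProx (α : ℝ) (f : E → EReal) (v p : E) : Prop :=
  IsMinOn (fun u => f u + ((1 / (2 * α) * ‖u - v‖ ^ 2 : ℝ) : EReal)) Set.univ p

end ConvexAnalysis

/-- The data of the problem
`min_x max_y f₁ x + f₂ x + yᵀ B x - g₁ y - g₂ y` over `x ∈ ℝ^dx`, `y ∈ ℝ^dy`. -/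
structure MinimaxProblem (dx dy : ℕ) where
  f₁ : EuclideanSpace ℝ (Fin dx) → ℝ
  f₂ : EuclideanSpace ℝ (Fin dx) → EReal
  g₁ : EuclideanSpace ℝ (Fin dy) → ℝ
  g₂ : EuclideanSpace ℝ (Fin dy) → EReal
  B : Matrix (Fin dy) (Fin dx) ℝ

namespace MinimaxProblem

variable {dx dy : ℕ} (P : MinimaxProblem dx dy)

/-- `x ↦ B x`. -/
def mulB : EuclideanSpace ℝ (Fin dx) →ₗ[ℝ] EuclideanSpace ℝ (Fin dy) :=
  Matrix.toEuclideanLin P.B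

/-- `y ↦ Bᵀ y`. -/
def mulBT : EuclideanSpace ℝ (Fin dy) →ₗ[ℝ] EuclideanSpace ℝ (Fin dx) :=
  Matrix.toEuclideanLin P.B.transpose

/-- The largest singular value of `B` (Mathlib lists the singular values in decreasing order). -/
def sigmaMax : ℝ := P.mulB.singularValues 0

/-- `ℒ(x, y) = f₁ x + f₂ x + yᵀ B x - g₁ y - g₂ y`. -/
def lagr (x : EuclideanSpace ℝ (Fin dx)) (y : EuclideanSpace ℝ (Fin dy)) : EReal :=
  (P.f₁ x : EReal) + P.f₂ x + ((inner ℝ y (P.mulB x) : ℝ) : EReal) - (P.g₁ y : EReal) - P.g₂ y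

/-- `(xs, ys)` solves the minimax problem: it is a saddle point of `ℒ`, i.e.
`ℒ(xs, y) ≤ ℒ(xs, ys) ≤ ℒ(x, ys)` for all `x`, `y`. (When `f₂` and `g₂` are proper, this forces
`f₂ xs` and `g₂ ys` to be finite.) -/
def IsSolution (xs : EuclideanSpace ℝ (Fin dx)) (ys : EuclideanSpace ℝ (Fin dy)) : Prop :=
  IsSaddlePointOn Set.univ Set.univ P.lagr xs ys

/-- The basic assumption on `f₁`, `f₂`, `g₁`, `g₂`. -/
structure BasicAssumption (μx Lx Ly : ℝ) : Prop where
  μx_pos : 0 < μx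
  μx_le_Lx : μx ≤ Lx
  f₁_strongConvex : StrongConvexOn Set.univ μx P.f₁
  f₁_smooth : IsLSmooth Lx P.f₁
  Ly_nonneg : 0 ≤ Ly
  g₁_convex : ConvexOn ℝ Set.univ P.g₁
  g₁_smooth : IsLSmooth Ly P.g₁
  f₂_proper : IsProperFun P.f₂
  f₂_convex : EConvex P.f₂
  f₂_lsc : LowerSemicontinuous P.f₂
  g₂_proper : IsProperFun P.g₂
  g₂_convex : EConvex P.g₂
  g₂_lsc : LowerSemicontinuous P.g₂

/-- `φ(y) = g₁ y + (f₁ + f₂)^*(-Bᵀ y)`. -/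
def phi (y : EuclideanSpace ℝ (Fin dy)) : EReal :=
  (P.g₁ y : EReal) + fenchelConj (fun x => (P.f₁ x : EReal) + P.f₂ x) (-P.mulBT y)

/-- `u = x^*(z)`: `u` is an exact minimizer of the subproblem
`min_x f₁ x + f₂ x + ⟨Bᵀ z, x⟩`. -/
def IsInnerSolution (z : EuclideanSpace ℝ (Fin dy)) (u : EuclideanSpace ℝ (Fin dx)) : Prop :=
  IsMinOn (fun x => (P.f₁ x : EReal) + P.f₂ x + ((inner ℝ (P.mulBT z) x : ℝ) : EReal)) Set.univ u

/-- The smoothness constant `L_φ = L_y + σ_max(B)² / μ_x` of `φ`. -/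
def Lphi (μx Ly : ℝ) : ℝ := Ly + P.sigmaMax ^ 2 / μx

/-- `κ_φ = (σ_max(B)² + μ_x L_y) / (μ_x μ_φ)`. -/
def kappaPhi (μx Ly μφ : ℝ) : ℝ := (P.sigmaMax ^ 2 + μx * Ly) / (μx * μφ)

/-- The momentum parameter `β_k` of iDAPG with inputs `L_φ` and `μ_φ`. -/
def betaPhi (Lφ μφ : ℝ) (k : ℕ) : ℝ :=
  if 0 < μφ then (Real.sqrt (Lφ / μφ) - 1) / (Real.sqrt (Lφ / μφ) + 1)
  else (k : ℝ) / ((k : ℝ) + 3)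

/-- `(x, y, z)` are the iterates of iDAPG with inputs `L_φ`, `μ_φ`, `x 0`, `y 0`; here
`x (k + 1)` is the inexact solution of the `k`-th subproblem, whose accuracy is prescribed
separately by `MeetsErrorCondition`. -/
structure IsIDAPG (Lφ μφ : ℝ) (x : ℕ → EuclideanSpace ℝ (Fin dx))
    (y z : ℕ → EuclideanSpace ℝ (Fin dy)) : Prop where
  init : z 0 = y 0
  y_step : ∀ k, IsProx (1 / Lφ) P.g₂
    (z k - (1 / Lφ) • (gradient P.g₁ (z k) - P.mulB (x (k + 1)))) (y (k + 1))
  z_step : ∀ k, z (k + 1) = y (k + 1) + betaPhi Lφ μφ k • (y (k + 1) - y k)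

/-- The error condition `‖x^{k+1} - x^*(z^k)‖² ≤ ε_{k+1}² / σ_max(B)²`. (If `B = 0`, the
right-hand side is `0` by convention, i.e. the subproblem, which is then independent of `z`, is
solved exactly.) -/
def MeetsErrorCondition (ε : ℕ → ℝ) (x : ℕ → EuclideanSpace ℝ (Fin dx))
    (z : ℕ → EuclideanSpace ℝ (Fin dy)) : Prop :=
  ∀ k, ∃ u, P.IsInnerSolution (z k) u ∧ ‖x (k + 1) - u‖ ^ 2 ≤ ε (k + 1) ^ 2 / P.sigmaMax ^ 2

end MinimaxProblem

end

/-!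
Write `h y = (f₁ + f₂)^*(-Bᵀ y)`, so that `φ = g₁ + h`. If `u` solves the inner problem at `z`, then
`f₁ + f₂ + ⟪Bᵀ z, ·⟫` grows at least like `μx / 2 * ‖x - u‖ ^ 2` away from `u`. Hence `-B u` is a
subgradient of `h` at `z`, and `h` lies below its linearization at `z` plus
`σ_max(B) ^ 2 / (2 μx) * ‖· - z‖ ^ 2` (`MinimaxProblem.BasicAssumption.dualFun_bounds`). Together
with the descent lemma for `g₁` and the strong convexity of `φ`, this places `φ` between quadratics
of curvature `μφ` and `Lφ` that touch it at `z` with slope `∇g₁ z - B u`; neither differentiability of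
`h` nor existence of minimizers in general is needed. A saddle point `(xs, ys)` gives a minimizer `ys`
of `φ + g₂`.

So iDAPG is an accelerated proximal gradient method for `φ + g₂` in which the gradient used at `z k`
is off by `e k = B (u k - x (k + 1))`, where `‖e k‖ ≤ |ε (k + 1)|` decays like `√θ ^ k`. Let
`α = √(μφ / Lφ)`, let `v k = y (k - 1) + (y k - y (k - 1)) / α`, and let `V k` be the gap of
`φ + g₂` at `y k` plus `μφ / 2 * ‖ys - v k‖ ^ 2`. Then
`V (k + 1) ≤ (1 - α) * V k + α * ⟪e k, ys - v (k + 1)⟫` (`lyapunov_step`), and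
since `‖ys - v (k + 1)‖` is at most a multiple of `√(V (k + 1))`, this becomes the linear recursion
`√(V (k + 1)) ≤ √(1 - α) * √(V k) + C * √θ ^ k` (`inexact_apg_recursion`). Its solutions are
`O(max (√(1 - α)) √θ ^ k)`, or `O(k * √θ ^ k)` in the resonant case; squaring gives the rates for `y`.
The rates for `x` follow because `z ↦ x^*(z)` is Lipschitz and `xs = x^*(ys)`.
-/

/-! ### Singular values -/

/-- Expansion of `‖T v‖ ^ 2 = ⟪T† T v, v⟫` in an eigenbasis of `T† T`. -/
theorem LinearMap.norm_apply_le_singularValues_zero {E F : Type*}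
    [NormedAddCommGroup E] [InnerProductSpace ℝ E] [FiniteDimensional ℝ E]
    [NormedAddCommGroup F] [InnerProductSpace ℝ F] [FiniteDimensional ℝ F]
    (T : E →ₗ[ℝ] F) (v : E) : ‖T v‖ ≤ T.singularValues 0 * ‖v‖ := by
  refine le_of_sq_le_sq ?_ (mul_nonneg (T.singularValues_nonneg 0) (norm_nonneg v))
  have hT := T.isSymmetric_adjoint_comp_self
  set b := hT.eigenvectorBasis rfl with hb
  have h1 : ‖T v‖ ^ 2 = inner ℝ ((LinearMap.adjoint T ∘ₗ T) v) v := by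
    rw [LinearMap.comp_apply, LinearMap.adjoint_inner_left, real_inner_self_eq_norm_sq]
  rw [h1, ← b.sum_inner_mul_inner, mul_pow, ← b.sum_sq_norm_inner_right v, Finset.mul_sum]
  refine Finset.sum_le_sum fun i _ => ?_
  have h2 : inner ℝ ((LinearMap.adjoint T ∘ₗ T) v) (b i)
      = hT.eigenvalues rfl i * inner ℝ v (b i) := by
    rw [hT v (b i), hb, hT.apply_eigenvectorBasis rfl i, inner_smul_right]
    rfl
  have h3 : hT.eigenvalues rfl i ≤ T.singularValues 0 ^ 2 := by
    rw [← T.sq_singularValues_fin rfl i]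
    exact pow_le_pow_left₀ (T.singularValues_nonneg _) (T.singularValues_antitone (Nat.zero_le _)) 2
  rw [h2, real_inner_comm (b i) v, Real.norm_eq_abs, sq_abs]
  nlinarith [mul_le_mul_of_nonneg_right h3 (sq_nonneg (inner ℝ (b i) v))]

/-! ### Strongly convex and smooth functions -/

section Analysis

variable {E : Type*} [NormedAddCommGroup E] [InnerProductSpace ℝ E]

/-- Quadratic growth of a strongly convex function away from a minimizer. -/
theorem StrongConvexOn.add_sq_norm_sub_le_of_isMinOn {s : Set E} {m : ℝ} {f : E → ℝ} {u w : E}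
    (hf : StrongConvexOn s m f) (hmin : IsMinOn f s u) (hu : u ∈ s) (hw : w ∈ s) :
    f u + m / 2 * ‖w - u‖ ^ 2 ≤ f w := by
  have key : ∀ t ∈ Set.Ioo (0 : ℝ) 1, f u + (1 - t) * (m / 2 * ‖w - u‖ ^ 2) ≤ f w := by
    intro t ht
    have hs : (0 : ℝ) ≤ 1 - t := by linarith [ht.2]
    have h1 := hf.2 hw hu ht.1.le hs (by ring)
    have h2 := isMinOn_iff.1 hmin _ (hf.1 hw hu ht.1.le hs (by ring))
    simp only [smul_eq_mul] at h1
    have h3 : t * (f u + (1 - t) * (m / 2 * ‖w - u‖ ^ 2)) ≤ t * f w := by linarith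
    exact le_of_mul_le_mul_left h3 ht.1
  -- The factor `1 - t` disappears as the convex combination tends to `u`.
  have hlim : Tendsto (fun t : ℝ => f u + (1 - t) * (m / 2 * ‖w - u‖ ^ 2))
      (nhdsWithin 0 (Set.Ioi 0)) (nhds (f u + (1 - 0) * (m / 2 * ‖w - u‖ ^ 2))) := by
    refine Tendsto.mono_left (Continuous.tendsto ?_ _) nhdsWithin_le_nhds
    fun_prop
  have := le_of_tendsto hlim (eventually_of_mem (Ioo_mem_nhdsGT one_pos) key)
  simpa using this

theorem StrongConvexOn.add_convexOn {s : Set E} {m : ℝ} {f g : E → ℝ}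
    (hf : StrongConvexOn s m f) (hg : ConvexOn ℝ s g) :
    StrongConvexOn s m (fun x => f x + g x) := by
  refine ⟨hf.1, fun x hx y hy a b ha hb hab => ?_⟩
  have h1 := hf.2 hx hy ha hb hab
  have h2 := hg.2 hx hy ha hb hab
  simp only [smul_eq_mul] at *
  linarith

theorem convexOn_inner_left {s : Set E} (hs : Convex ℝ s) (q : E) :
    ConvexOn ℝ s (fun x => inner ℝ q x) :=
  (innerSL ℝ q).toLinearMap.convexOn hs

theorem strongConvexOn_sq_norm_sub {s : Set E} (hs : Convex ℝ s) (m : ℝ) (v : E) :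
    StrongConvexOn s m (fun x => m / 2 * ‖x - v‖ ^ 2) := by
  refine ⟨hs, fun x _ y _ a b _ _ hab => le_of_eq ?_⟩
  obtain rfl : b = 1 - a := by linarith
  have e : a • x + (1 - a) • y - v = a • (x - v) + (1 - a) • (y - v) := by module
  have e2 : x - y = (x - v) - (y - v) := by abel
  simp only [smul_eq_mul]
  rw [e, e2, norm_add_sq_real, norm_sub_sq_real (x - v) (y - v), norm_smul, norm_smul,
    inner_smul_left, inner_smul_right, mul_pow, mul_pow, Real.norm_eq_abs, Real.norm_eq_abs, sq_abs,
    sq_abs]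
  simp only [conj_trivial]
  ring

/-- A subgradient inequality for a strongly convex function improves by the quadratic term. -/
theorem StrongConvexOn.add_inner_add_sq_norm_le {s : Set E} {m : ℝ} {f : E → ℝ} {z w q : E}
    (hf : StrongConvexOn s m f) (hz : z ∈ s) (hw : w ∈ s)
    (hq : ∀ v ∈ s, f z + inner ℝ q (v - z) ≤ f v) :
    f z + inner ℝ q (w - z) + m / 2 * ‖w - z‖ ^ 2 ≤ f w := by
  have h := (hf.add_convexOn (convexOn_inner_left hf.1 (-q))).add_sq_norm_sub_le_of_isMinOn
    (u := z) (isMinOn_iff.2 fun v hv => ?_) hz hw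
  · simp only [inner_neg_left, inner_sub_right] at *
    linarith
  · have := hq v hv
    simp only [inner_neg_left, inner_sub_right] at *
    linarith

theorem hasDerivAt_comp_add_smul [CompleteSpace E] {g : E → ℝ} (hg : Differentiable ℝ g)
    (z d : E) (t : ℝ) :
    HasDerivAt (fun t : ℝ => g (z + t • d)) (inner ℝ (gradient g (z + t • d)) d) t := by
  have h1 : HasDerivAt (fun t : ℝ => z + t • d) d t := by
    simpa using ((hasDerivAt_id t).smul_const d).const_add z
  have h2 := ((hg (z + t • d)).hasGradientAt.hasFDerivAt).comp_hasDerivAt t h1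
  simpa using! h2

theorem ConvexOn.add_inner_gradient_le [CompleteSpace E] {g : E → ℝ}
    (hc : ConvexOn ℝ Set.univ g) (hg : Differentiable ℝ g) (z w : E) :
    g z + inner ℝ (gradient g z) (w - z) ≤ g w := by
  have hline : ConvexOn ℝ Set.univ (fun t : ℝ => g (z + t • (w - z))) := by
    refine ⟨convex_univ, fun a _ b _ s t hs ht hst => ?_⟩
    obtain rfl : t = 1 - s := by linarith
    have := hc.2 (Set.mem_univ (z + a • (w - z))) (Set.mem_univ (z + b • (w - z))) hs ht hst
    convert! this using 2
    simp only [smul_eq_mul]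
    module
  have h := hline.le_slope_of_hasDerivAt (Set.mem_univ 0) (Set.mem_univ 1) one_pos
    (hasDerivAt_comp_add_smul hg z (w - z) 0)
  simp only [slope_def_field, one_smul, zero_smul, add_zero, sub_zero, div_one,
    add_sub_cancel] at h
  linarith

/-- The descent lemma. -/
theorem IsLSmooth.le_add_inner_add_sq_norm [CompleteSpace E] {L : ℝ} {g : E → ℝ}
    (hg : IsLSmooth L g) (z w : E) :
    g w ≤ g z + inner ℝ (gradient g z) (w - z) + L / 2 * ‖w - z‖ ^ 2 := by
  set d := w - z with hd
  -- Along the segment, the defect of the inequality has nonpositive derivative.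
  have hder : ∀ t : ℝ, HasDerivAt
      (fun t : ℝ => g (z + t • d) - t * inner ℝ (gradient g z) d - L / 2 * ‖d‖ ^ 2 * t ^ 2)
      (inner ℝ (gradient g (z + t • d)) d - inner ℝ (gradient g z) d - L * ‖d‖ ^ 2 * t) t := by
    intro t
    have h1 := (hasDerivAt_comp_add_smul hg.1 z d t).sub
      ((hasDerivAt_id t).mul_const (inner ℝ (gradient g z) d))
    have h2 := h1.sub ((hasDerivAt_pow 2 t).const_mul (L / 2 * ‖d‖ ^ 2))
    convert! h2 using 1
    simp
    ring
  have hanti := antitoneOn_of_deriv_nonpos (convex_Ici (0 : ℝ))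
    (f := fun t : ℝ => g (z + t • d) - t * inner ℝ (gradient g z) d - L / 2 * ‖d‖ ^ 2 * t ^ 2)
    (fun t _ => (hder t).continuousAt.continuousWithinAt)
    (fun t _ => (hder t).differentiableAt.differentiableWithinAt) (fun t ht => by
      rw [interior_Ici, Set.mem_Ioi] at ht
      rw [(hder t).deriv, ← inner_sub_left]
      have h1 := real_inner_le_norm (gradient g (z + t • d) - gradient g z) d
      have h2 := hg.2 (z + t • d) z
      rw [add_sub_cancel_left, norm_smul, Real.norm_eq_abs, abs_of_pos ht] at h2
      nlinarith [mul_le_mul_of_nonneg_right h2 (norm_nonneg d)])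
  have h := hanti (Set.mem_Ici.2 le_rfl) (Set.mem_Ici.2 zero_le_one) zero_le_one
  simp only [one_smul, zero_smul] at h
  rw [show z + d = w by rw [hd]; abel, add_zero] at h
  linarith

/-! ### The inexact accelerated proximal gradient method -/

/-- One proximal gradient step from `z` to `p` for `φ + G`, with the gradient `q` of `φ` at `z`
replaced by `q + e`, compared with an arbitrary point `w`. The proximal objective is `L`-strongly
convex, which yields the term `-L / 2 * ‖w - p‖ ^ 2`. -/
theorem proximal_gradient_step {D : Set E} {φ G : E → ℝ} {L μ : ℝ} {z q e p w : E}
    (hL : 0 < L) (hG : ConvexOn ℝ D G) (hp : p ∈ D) (hw : w ∈ D)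
    (hprox : IsMinOn (fun u => G u + L / 2 * ‖u - (z - (1 / L) • (q + e))‖ ^ 2) D p)
    (hup : φ p ≤ φ z + inner ℝ q (p - z) + L / 2 * ‖p - z‖ ^ 2)
    (hlow : φ z + inner ℝ q (w - z) + μ / 2 * ‖w - z‖ ^ 2 ≤ φ w) :
    φ p + G p ≤ φ w + G w + (L - μ) / 2 * ‖w - z‖ ^ 2 - L / 2 * ‖w - p‖ ^ 2
      + inner ℝ e (w - p) := by
  have hsc := (strongConvexOn_sq_norm_sub hG.1 L (z - (1 / L) • (q + e))).add_convexOn hG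
  have h := hsc.add_sq_norm_sub_le_of_isMinOn
    (by simpa only [add_comm] using hprox) hp hw
  have expand : ∀ u : E, L / 2 * ‖u - (z - (1 / L) • (q + e))‖ ^ 2 =
      L / 2 * ‖u - z‖ ^ 2 + inner ℝ (q + e) (u - z) + 1 / (2 * L) * ‖q + e‖ ^ 2 := by
    intro u
    rw [show u - (z - (1 / L) • (q + e)) = (u - z) + (1 / L) • (q + e) by abel, norm_add_sq_real,
      norm_smul, inner_smul_right, mul_pow, Real.norm_eq_abs, sq_abs, real_inner_comm]
    field_simp
  simp only [expand] at h
  have e1 : inner ℝ (q + e) (w - z) - inner ℝ (q + e) (p - z)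
      = inner ℝ q (w - z) - inner ℝ q (p - z) + inner ℝ e (w - p) := by
    simp only [inner_add_left, inner_sub_right]
    ring
  linarith

/-- One step of the accelerated method, from `yp`, `y` to `p`. With
`v = yp + (y - yp) / α` and `α = √(μ / L)`, the Lyapunov function
`(φ + G) y - (φ + G) ys + μ / 2 * ‖ys - v‖ ^ 2` contracts by the factor `1 - α`, up to the gradient
error `e`. -/
theorem lyapunov_step {D : Set E} {φ G : E → ℝ} {L μ α : ℝ} {yp y p z q e ys : E}
    (hL : 0 < L) (hα : 0 < α) (hα1 : α ≤ 1) (hμ : L * α ^ 2 = μ)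
    (hφ : StrongConvexOn Set.univ μ φ) (hG : ConvexOn ℝ D G)
    (hp : p ∈ D) (hy : y ∈ D) (hys : ys ∈ D)
    (hz : z = y + ((1 - α) / (1 + α)) • (y - yp))
    (hprox : IsMinOn (fun u => G u + L / 2 * ‖u - (z - (1 / L) • (q + e))‖ ^ 2) D p)
    (hup : φ p ≤ φ z + inner ℝ q (p - z) + L / 2 * ‖p - z‖ ^ 2)
    (hlow : ∀ w, φ z + inner ℝ q (w - z) + μ / 2 * ‖w - z‖ ^ 2 ≤ φ w) :
    φ p + G p - (φ ys + G ys) + μ / 2 * ‖ys - (y + (1 / α) • (p - y))‖ ^ 2 ≤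
      (1 - α) * (φ y + G y - (φ ys + G ys) + μ / 2 * ‖ys - (yp + (1 / α) • (y - yp))‖ ^ 2)
      + α * inner ℝ e (ys - (y + (1 / α) • (p - y))) := by
  have hα1' : 0 ≤ 1 - α := by linarith
  -- For this comparison point, `w - p` is `α` times the new difference `ys - v`, and `w - z` is
  -- `α` times a convex combination of `ys - y` and the old `ys - v`.
  set w := (1 - α) • y + α • ys with hw
  have hwD : w ∈ D := hG.1 hy hys hα1' hα.le (by ring)
  have hstep := proximal_gradient_step (μ := μ) hL hG hp hwD hprox hup (hlow w)
  have h1 := hφ.2 (Set.mem_univ y) (Set.mem_univ ys) hα1' hα.le (by ring)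
  have h2 := hG.2 hy hys hα1' hα.le (by ring)
  simp only [smul_eq_mul, ← hw] at h1 h2
  set s' := ys - (y + (1 / α) • (p - y)) with hs'
  set s := ys - (yp + (1 / α) • (y - yp)) with hs
  have ew : w - p = α • s' := by
    rw [hw, hs', smul_sub, smul_add, smul_smul, mul_one_div_cancel hα.ne']
    module
  have ez : w - z = α • ((α / (1 + α)) • (ys - y) + (1 / (1 + α)) • s) := by
    rw [hw, hs, hz]
    have : (1 + α) ≠ 0 := by positivity
    match_scalars <;> field_simp <;> ring
  have hconv : ‖(α / (1 + α)) • (ys - y) + (1 / (1 + α)) • s‖ ^ 2 ≤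
      (α / (1 + α)) * ‖ys - y‖ ^ 2 + (1 / (1 + α)) * ‖s‖ ^ 2 := by
    have h := (strongConvexOn_sq_norm_sub (convex_univ (𝕜 := ℝ) (E := E)) 2 0).2
      (Set.mem_univ (ys - y)) (Set.mem_univ s) (show 0 ≤ α / (1 + α) by positivity)
      (show 0 ≤ 1 / (1 + α) by positivity) (by field_simp; ring)
    simp only [smul_eq_mul, sub_zero] at h
    have : 0 ≤ α / (1 + α) * (1 / (1 + α)) * (2 / 2 * ‖ys - y - s‖ ^ 2) := by positivity
    linarith
  have nz : ‖w - z‖ ^ 2 ≤ α ^ 2 * ((α / (1 + α)) * ‖ys - y‖ ^ 2 + (1 / (1 + α)) * ‖s‖ ^ 2) := by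
    rw [ez, norm_smul, mul_pow, Real.norm_eq_abs, sq_abs]
    gcongr
  have hLμ : 0 ≤ (L - μ) / 2 := by
    nlinarith [mul_nonneg hL.le (mul_nonneg hα1' hα.le), mul_nonneg hL.le hα1']
  have nz2 := mul_le_mul_of_nonneg_left nz hLμ
  -- The term in `‖ys - y‖ ^ 2` is exactly the gain from the strong convexity of `φ` in `h1`.
  have e3 : (L - μ) / 2 * (α ^ 2 * ((α / (1 + α)) * ‖ys - y‖ ^ 2 + (1 / (1 + α)) * ‖s‖ ^ 2))
      = μ / 2 * (1 - α) * (α * ‖ys - y‖ ^ 2 + ‖s‖ ^ 2) := by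
    rw [← hμ]
    field_simp
    ring
  have e4 : L / 2 * ‖w - p‖ ^ 2 = μ / 2 * ‖s'‖ ^ 2 := by
    rw [ew, norm_smul, mul_pow, Real.norm_eq_abs, sq_abs, ← hμ]
    ring
  rw [norm_sub_rev y ys] at h1
  rw [e4, ew, inner_smul_right] at hstep
  rw [e3] at nz2
  linarith

theorem le_add_of_sq_le_sq_add_mul {a b d : ℝ} (hb : 0 ≤ b) (hd : 0 ≤ d)
    (h : a ^ 2 ≤ b ^ 2 + d * a) : a ≤ b + d := by
  by_contra! hlt
  nlinarith

theorem exists_le_mul_max_pow {a : ℕ → ℝ} {r t C : ℝ} (hr : 0 ≤ r) (ht : 0 ≤ t) (hrt : t ≠ r)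
    (h : ∀ k, a (k + 1) ≤ r * a k + C * t ^ k) : ∃ K, ∀ k, a k ≤ K * max r t ^ k := by
  rcases lt_or_gt_of_ne hrt with hlt | hlt
  · refine ⟨a 0 + |C| / (r - t), fun k => ?_⟩
    have hpos : 0 < r - t := by linarith
    have hk : a k + |C| / (r - t) * t ^ k ≤ (a 0 + |C| / (r - t)) * r ^ k := by
      induction k with
      | zero => simp
      | succ k ih =>
        have h1 := mul_le_mul_of_nonneg_left ih hr
        have h2 : C * t ^ k ≤ |C| * t ^ k := by gcongr; exact le_abs_self C
        have h3 : |C| * t ^ k = |C| / (r - t) * (r - t) * t ^ k := by field_simp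
        rw [pow_succ, pow_succ]
        linarith [h k]
    rw [max_eq_left hlt.le]
    have : 0 ≤ |C| / (r - t) * t ^ k := by positivity
    linarith
  · refine ⟨max (a 0) (C / (t - r)), fun k => ?_⟩
    have hpos : 0 < t - r := by linarith
    rw [max_eq_right hlt.le]
    induction k with
    | zero => simp
    | succ k ih =>
      have h1 := mul_le_mul_of_nonneg_left ih hr
      have h2 : C / (t - r) * (t - r) * t ^ k ≤ max (a 0) (C / (t - r)) * (t - r) * t ^ k := by
        gcongr
        exact le_max_right _ _
      rw [div_mul_cancel₀ _ hpos.ne'] at h2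
      rw [pow_succ]
      linarith [h k]

theorem exists_le_mul_succ_mul_pow {a : ℕ → ℝ} {t C : ℝ} (ht : 0 < t)
    (h : ∀ k, a (k + 1) ≤ t * a k + C * t ^ k) : ∃ K, ∀ k, a k ≤ K * ((k + 1) * t ^ k) := by
  refine ⟨max (a 0) (C / t), fun k => ?_⟩
  induction k with
  | zero => simp
  | succ k ih =>
    have h1 := mul_le_mul_of_nonneg_left ih ht.le
    have h2 : C / t * t ^ (k + 1) ≤ max (a 0) (C / t) * t ^ (k + 1) := by
      gcongr
      exact le_max_right _ _
    have h3 : C / t * t ^ (k + 1) = C * t ^ k := by rw [pow_succ]; field_simp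
    push_cast
    rw [pow_succ] at *
    linarith [h k]

end Analysis

section Accelerated

variable {E : Type*} [NormedAddCommGroup E] [InnerProductSpace ℝ E]

/-- The square root `a k` of the rescaled Lyapunov function bounds the distance to the minimizer and
satisfies a linear recursion driven by the gradient errors. The Lyapunov function is considered from
`y 1` on only, because `y 0` need not lie in the domain `D`. -/
theorem inexact_apg_recursion {D : Set E} {φ G : E → ℝ} {L μ C t : ℝ} {ys : E} {y z q e : ℕ → E}
    (hμ : 0 < μ) (hμL : μ ≤ L) (ht : 0 ≤ t) (hC : 0 ≤ C)
    (hφ : StrongConvexOn Set.univ μ φ) (hG : ConvexOn ℝ D G)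
    (hys : ys ∈ D) (hmin : IsMinOn (fun u => φ u + G u) D ys)
    (hyD : ∀ k, y (k + 1) ∈ D)
    (hz : ∀ k, z (k + 1) =
      y (k + 1) + ((√(L / μ) - 1) / (√(L / μ) + 1)) • (y (k + 1) - y k))
    (hprox : ∀ k, IsMinOn (fun u => G u + L / 2 * ‖u - (z k - (1 / L) • (q k + e k))‖ ^ 2)
      D (y (k + 1)))
    (hup : ∀ k p, φ p ≤ φ (z k) + inner ℝ (q k) (p - z k) + L / 2 * ‖p - z k‖ ^ 2)
    (hlow : ∀ k w, φ (z k) + inner ℝ (q k) (w - z k) + μ / 2 * ‖w - z k‖ ^ 2 ≤ φ w)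
    (he : ∀ k, ‖e (k + 1)‖ ≤ C * t ^ k) :
    ∃ (a : ℕ → ℝ) (C' : ℝ), (∀ k, ‖y (k + 1) - ys‖ ≤ a k) ∧
      ∀ k, a (k + 1) ≤ √(1 - 1 / √(L / μ)) * a k + C' * t ^ k := by
  have hL : 0 < L := hμ.trans_le hμL
  have hκ : 1 ≤ √(L / μ) := Real.one_le_sqrt.2 ((one_le_div hμ).2 hμL)
  have hκ0 : 0 < √(L / μ) := by linarith
  set α : ℝ := 1 / √(L / μ) with hα
  have hα0 : 0 < α := by positivity
  have hα1 : α ≤ 1 := by rw [hα, div_le_one hκ0]; exact hκ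
  have hLα : L * α ^ 2 = μ := by
    rw [hα, div_pow, Real.sq_sqrt (by positivity)]
    field_simp
  have hβ : (√(L / μ) - 1) / (√(L / μ) + 1) = (1 - α) / (1 + α) := by
    rw [hα]
    field_simp
  set s : ℕ → E := fun k => ys - (y k + (1 / α) • (y (k + 1) - y k)) with hs
  set V : ℕ → ℝ := fun k =>
    φ (y (k + 1)) + G (y (k + 1)) - (φ ys + G ys) + μ / 2 * ‖s k‖ ^ 2 with hV
  have hgrowth : ∀ k, μ / 2 * ‖y (k + 1) - ys‖ ^ 2 ≤
      φ (y (k + 1)) + G (y (k + 1)) - (φ ys + G ys) := by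
    intro k
    have hφD : StrongConvexOn D μ φ :=
      ⟨hG.1, fun x _ y _ => hφ.2 (Set.mem_univ x) (Set.mem_univ y)⟩
    have := (hφD.add_convexOn hG).add_sq_norm_sub_le_of_isMinOn hmin hys (hyD k)
    linarith
  have hV0 : ∀ k, 0 ≤ V k := by
    intro k
    have h1 : 0 ≤ μ / 2 * ‖y (k + 1) - ys‖ ^ 2 := by positivity
    have h2 : 0 ≤ μ / 2 * ‖s k‖ ^ 2 := by positivity
    simp only [hV]
    linarith [hgrowth k]
  have hsq : ∀ k, √(2 / μ * V k) ^ 2 = 2 / μ * V k := fun k =>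
    Real.sq_sqrt (mul_nonneg (by positivity) (hV0 k))
  have hle : ∀ (k : ℕ) (v : E), μ / 2 * ‖v‖ ^ 2 ≤ V k → ‖v‖ ≤ √(2 / μ * V k) := by
    intro k v hv
    refine Real.le_sqrt_of_sq_le ?_
    calc ‖v‖ ^ 2 = 2 / μ * (μ / 2 * ‖v‖ ^ 2) := by field_simp
      _ ≤ 2 / μ * V k := by gcongr
  refine ⟨fun k => √(2 / μ * V k), 2 * α / μ * C, fun k => hle k _ ?_, fun k => ?_⟩
  · have h2 : 0 ≤ μ / 2 * ‖s k‖ ^ 2 := by positivity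
    simp only [hV]
    linarith [hgrowth k]
  · have hstep := lyapunov_step hL hα0 hα1 hLα hφ hG (hyD (k + 1)) (hyD k) hys
      ((hz k).trans (by rw [hβ])) (hprox (k + 1)) (hup (k + 1) _) (hlow (k + 1))
    have hstep' : V (k + 1) ≤ (1 - α) * V k + α * inner ℝ (e (k + 1)) (s (k + 1)) := hstep
    have hs1 : ‖s (k + 1)‖ ≤ √(2 / μ * V (k + 1)) := by
      refine hle _ _ ?_
      have h1 : 0 ≤ μ / 2 * ‖y (k + 1 + 1) - ys‖ ^ 2 := by positivity
      simp only [hV]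
      linarith [hgrowth (k + 1)]
    have hin : inner ℝ (e (k + 1)) (s (k + 1)) ≤ C * t ^ k * √(2 / μ * V (k + 1)) :=
      (real_inner_le_norm _ _).trans (mul_le_mul (he k) hs1 (norm_nonneg _) (by positivity))
    -- `V (k + 1) ≤ (1 - α) V k + O(t ^ k √V (k + 1))` is quadratic in `√V (k + 1)`.
    refine le_add_of_sq_le_sq_add_mul (by positivity) (by positivity) ?_
    rw [mul_pow, hsq, hsq, Real.sq_sqrt (by linarith)]
    calc 2 / μ * V (k + 1)
        ≤ 2 / μ * ((1 - α) * V k + α * (C * t ^ k * √(2 / μ * V (k + 1)))) := by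
          gcongr
          exact hstep'.trans (by gcongr)
      _ = _ := by ring

end Accelerated

/-! ### Extended-real-valued functions and their real parts -/

section Extended

theorem IsProperFun.coe_toReal {E : Type*} {f : E → EReal} (hf : IsProperFun f) {x : E}
    (hx : f x ≠ ⊤) :
    ((f x).toReal : EReal) = f x :=
  EReal.coe_toReal hx (hf.1 x)

variable {E : Type*} [NormedAddCommGroup E] [InnerProductSpace ℝ E]

/-- Minimization over the whole space of an extended-real-valued function is minimization of its
real part over its domain; in particular a minimizer lies in the domain. -/
theorem IsProperFun.isMinOn_toReal {E : Type*} {f : E → EReal} (hf : IsProperFun f)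
    {ℓ : E → ℝ} {u : E}
    (h : IsMinOn (fun x => f x + (ℓ x : EReal)) Set.univ u) :
    f u ≠ ⊤ ∧ IsMinOn (fun x => (f x).toReal + ℓ x) {x | f x ≠ ⊤} u := by
  have h' := fun x => isMinOn_iff.1 h x (Set.mem_univ x)
  have hu : f u ≠ ⊤ := by
    obtain ⟨x₀, hx₀⟩ := hf.2
    intro hu
    have := h' x₀
    rw [hu, EReal.top_add_coe, ← hf.coe_toReal hx₀, ← EReal.coe_add] at this
    exact EReal.coe_ne_top _ (top_le_iff.1 this)
  refine ⟨hu, isMinOn_iff.2 fun x hx => ?_⟩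
  have := h' x
  rw [← hf.coe_toReal hu, ← hf.coe_toReal hx] at this
  exact_mod_cast this

theorem EConvex.convexOn_toReal {f : E → EReal} (hc : EConvex f) (hf : IsProperFun f) :
    ConvexOn ℝ {x | f x ≠ ⊤} (fun x => (f x).toReal) := by
  have key : ∀ ⦃x⦄, f x ≠ ⊤ → ∀ ⦃y⦄, f y ≠ ⊤ → ∀ ⦃a b : ℝ⦄, 0 < a → 0 < b → a + b = 1 →
      f (a • x + b • y) ≤ ((a * (f x).toReal + b * (f y).toReal : ℝ) : EReal) := by
    intro x hx y hy a b ha hb hab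
    have h := hc (x := x) (y := y) ha hb hab
    rw [← hf.coe_toReal hx, ← hf.coe_toReal hy] at h
    exact_mod_cast h
  have hconv : Convex ℝ {x | f x ≠ ⊤} :=
    convex_iff_forall_pos.2 fun x hx y hy a b ha hb hab =>
      ne_top_of_le_ne_top (EReal.coe_ne_top _) (key hx hy ha hb hab)
  refine convexOn_iff_forall_pos.2 ⟨hconv, fun x hx y hy a b ha hb hab => ?_⟩
  have h := key hx hy ha hb hab
  rw [← hf.coe_toReal (hconv hx hy ha.le hb.le hab)] at h
  exact_mod_cast h

theorem EStrongConvex.strongConvexOn {μ : ℝ} {f : E → EReal} {φ : E → ℝ}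
    (hf : EStrongConvex μ f) (hφ : ∀ x, f x = φ x) : StrongConvexOn Set.univ μ φ := by
  refine ⟨convex_univ, fun x _ y _ a b ha hb hab => ?_⟩
  rcases ha.eq_or_lt with rfl | ha
  · obtain rfl : b = 1 := by linarith
    simp
  rcases hb.eq_or_lt with rfl | hb
  · obtain rfl : a = 1 := by linarith
    simp
  have h := hf (x := x) (y := y) ha hb hab
  rw [hφ, hφ, hφ] at h
  have h' : φ (a • x + b • y) + a * b * (μ / 2 * ‖x - y‖ ^ 2) ≤ a * φ x + b * φ y := by
    exact_mod_cast h
  simp only [smul_eq_mul]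
  linarith

end Extended

/-! ### The inner problem -/

namespace MinimaxProblem

variable {dx dy : ℕ} (P : MinimaxProblem dx dy)

theorem inner_mulBT (y : EuclideanSpace ℝ (Fin dy)) (x : EuclideanSpace ℝ (Fin dx)) :
    inner ℝ (P.mulBT y) x = inner ℝ y (P.mulB x) := by
  have h : P.mulBT = LinearMap.adjoint P.mulB := by
    rw [mulBT, mulB, ← Matrix.toEuclideanLin_conjTranspose_eq_adjoint]
    congr 1
  rw [h, LinearMap.adjoint_inner_left]

theorem norm_mulB_le (x : EuclideanSpace ℝ (Fin dx)) : ‖P.mulB x‖ ≤ P.sigmaMax * ‖x‖ :=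
  P.mulB.norm_apply_le_singularValues_zero x

theorem sigmaMax_nonneg : 0 ≤ P.sigmaMax := P.mulB.singularValues_nonneg 0

/-- The real-valued function `f₁ + f₂`; it is meaningful on `{x | P.f₂ x ≠ ⊤}` only. -/
noncomputable def primalFun (x : EuclideanSpace ℝ (Fin dx)) : ℝ := P.f₁ x + (P.f₂ x).toReal

variable {P} {μx Lx Ly : ℝ}

theorem BasicAssumption.strongConvexOn_primalFun (hP : P.BasicAssumption μx Lx Ly) :
    StrongConvexOn {x | P.f₂ x ≠ ⊤} μx P.primalFun := by
  have h2 := hP.f₂_convex.convexOn_toReal hP.f₂_proper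
  exact StrongConvexOn.add_convexOn
    ⟨h2.1, fun x _ y _ => hP.f₁_strongConvex.2 (Set.mem_univ x) (Set.mem_univ y)⟩ h2

/-- An inner solution lies in the domain of `f₂`, and the inner objective grows quadratically away
from it. -/
theorem BasicAssumption.growth_of_isInnerSolution (hP : P.BasicAssumption μx Lx Ly)
    {z : EuclideanSpace ℝ (Fin dy)} {u : EuclideanSpace ℝ (Fin dx)} (hu : P.IsInnerSolution z u) :
    P.f₂ u ≠ ⊤ ∧ ∀ x, P.f₂ x ≠ ⊤ →
      P.primalFun u + inner ℝ z (P.mulB u) + μx / 2 * ‖x - u‖ ^ 2 ≤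
        P.primalFun x + inner ℝ z (P.mulB x) := by
  have h := hP.f₂_proper.isMinOn_toReal (ℓ := fun x => P.f₁ x + inner ℝ (P.mulBT z) x) (u := u) (by
    unfold IsInnerSolution at hu
    convert hu using 2 with x
    rw [EReal.coe_add, ← add_assoc, add_comm (P.f₂ x)])
  refine ⟨h.1, fun x hx => ?_⟩
  have hs := hP.strongConvexOn_primalFun.add_convexOn
    (convexOn_inner_left hP.strongConvexOn_primalFun.1 (P.mulBT z))
  have := hs.add_sq_norm_sub_le_of_isMinOn (u := u) (isMinOn_iff.2 fun x hx => ?_) h.1 hx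
  · simpa only [inner_mulBT] using this
  · have := isMinOn_iff.1 h.2 x hx
    simp only [primalFun]
    linarith

/-- The inner solution map `z ↦ x^*(z)` is `σ_max(B) / μ_x`-Lipschitz. -/
theorem BasicAssumption.norm_sub_le_of_isInnerSolution (hP : P.BasicAssumption μx Lx Ly)
    {z w : EuclideanSpace ℝ (Fin dy)} {u v : EuclideanSpace ℝ (Fin dx)}
    (hu : P.IsInnerSolution z u) (hv : P.IsInnerSolution w v) :
    ‖u - v‖ ≤ P.sigmaMax / μx * ‖z - w‖ := by
  obtain ⟨hu1, hu2⟩ := hP.growth_of_isInnerSolution hu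
  obtain ⟨hv1, hv2⟩ := hP.growth_of_isInnerSolution hv
  have h1 := hu2 v hv1
  have h2 := hv2 u hu1
  rw [norm_sub_rev] at h1
  have h3 : μx * ‖u - v‖ ^ 2 ≤ inner ℝ (w - z) (P.mulB (u - v)) := by
    simp only [map_sub, inner_sub_left, inner_sub_right]
    linarith
  have h4 : inner ℝ (w - z) (P.mulB (u - v)) ≤ ‖z - w‖ * (P.sigmaMax * ‖u - v‖) := by
    rw [norm_sub_rev z w]
    exact (real_inner_le_norm _ _).trans (by gcongr; exact P.norm_mulB_le _)
  have hμ := hP.μx_pos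
  rcases (norm_nonneg (u - v)).eq_or_lt with h0 | h0
  · rw [← h0]
    have := P.sigmaMax_nonneg
    positivity
  · rw [div_mul_eq_mul_div, le_div_iff₀ hμ]
    refine le_of_mul_le_mul_right ?_ h0
    linarith

/-! ### The dual function -/

theorem fenchelConj_le_iff (hf₂ : IsProperFun P.f₂) (w : EuclideanSpace ℝ (Fin dy)) (c : ℝ) :
    fenchelConj (fun x => (P.f₁ x : EReal) + P.f₂ x) (-P.mulBT w) ≤ c ↔
      ∀ x, P.f₂ x ≠ ⊤ → -inner ℝ w (P.mulB x) - P.primalFun x ≤ c := by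
  rw [fenchelConj, iSup_le_iff]
  refine forall_congr' fun x => ?_
  by_cases hx : P.f₂ x = ⊤
  · simp [hx]
  · rw [← hf₂.coe_toReal hx, inner_neg_left, inner_mulBT, ← EReal.coe_add, ← EReal.coe_sub,
      EReal.coe_le_coe_iff]
    simp [primalFun]

/-- The dual function `h(y) = (f₁ + f₂)^*(-Bᵀ y)`, as a real number; it is finite as soon as one of
the inner problems has a solution. -/
noncomputable def dualFun (P : MinimaxProblem dx dy) (y : EuclideanSpace ℝ (Fin dy)) : ℝ :=
  (fenchelConj (fun x => (P.f₁ x : EReal) + P.f₂ x) (-P.mulBT y)).toReal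

theorem neg_inner_le_sq_norm_add_sq_norm (w d : EuclideanSpace ℝ (Fin dy))
    (v : EuclideanSpace ℝ (Fin dx)) (hμ : 0 < μx) (hd : ‖d‖ ≤ P.sigmaMax * ‖v‖) :
    -inner ℝ w d ≤ P.sigmaMax ^ 2 / μx / 2 * ‖w‖ ^ 2 + μx / 2 * ‖v‖ ^ 2 := by
  have h1 : -inner ℝ w d ≤ ‖w‖ * (P.sigmaMax * ‖v‖) := by
    rw [← inner_neg_right]
    refine (real_inner_le_norm _ _).trans ?_
    rw [norm_neg]
    gcongr
  have h2 : 0 ≤ (P.sigmaMax * ‖w‖ - μx * ‖v‖) ^ 2 / (2 * μx) := by positivity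
  have h3 : (P.sigmaMax * ‖w‖ - μx * ‖v‖) ^ 2 / (2 * μx) =
    P.sigmaMax ^ 2 / μx / 2 * ‖w‖ ^ 2 + μx / 2 * ‖v‖ ^ 2 - ‖w‖ * (P.sigmaMax * ‖v‖) := by
    field_simp
    ring
  linarith

theorem BasicAssumption.fenchelConj_le (hP : P.BasicAssumption μx Lx Ly)
    {z : EuclideanSpace ℝ (Fin dy)} {u : EuclideanSpace ℝ (Fin dx)} (hu : P.IsInnerSolution z u)
    (w : EuclideanSpace ℝ (Fin dy)) :
    fenchelConj (fun x => (P.f₁ x : EReal) + P.f₂ x) (-P.mulBT w) ≤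
      ((-inner ℝ w (P.mulB u) - P.primalFun u + P.sigmaMax ^ 2 / μx / 2 * ‖w - z‖ ^ 2 : ℝ) :
        EReal) := by
  rw [fenchelConj_le_iff hP.f₂_proper]
  intro x hx
  have h1 := (hP.growth_of_isInnerSolution hu).2 x hx
  have h2 := neg_inner_le_sq_norm_add_sq_norm (P := P) (w - z) (P.mulB (x - u)) (x - u) hP.μx_pos
    (P.norm_mulB_le _)
  simp only [map_sub, inner_sub_left, inner_sub_right] at h2
  linarith

theorem BasicAssumption.coe_dualFun (hP : P.BasicAssumption μx Lx Ly)
    {z : EuclideanSpace ℝ (Fin dy)} {u : EuclideanSpace ℝ (Fin dx)} (hu : P.IsInnerSolution z u)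
    (w : EuclideanSpace ℝ (Fin dy)) :
    (P.dualFun w : EReal) =
      fenchelConj (fun x => (P.f₁ x : EReal) + P.f₂ x) (-P.mulBT w) := by
  refine EReal.coe_toReal (ne_top_of_le_ne_top (EReal.coe_ne_top _) (hP.fenchelConj_le hu w)) ?_
  intro hbot
  have h := (fenchelConj_le_iff hP.f₂_proper w (-inner ℝ w (P.mulB u) - P.primalFun u - 1)).1
    (by rw [hbot]; exact bot_le) u (hP.growth_of_isInnerSolution hu).1
  linarith

/-- An inner solution `u` at `z` attains the conjugate there, and `-B u` is the gradient of the dual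
function at `z`: it is a subgradient, and the quadratic upper bound holds with constant
`σ_max(B)² / μ_x`. -/
theorem BasicAssumption.dualFun_bounds (hP : P.BasicAssumption μx Lx Ly)
    {z : EuclideanSpace ℝ (Fin dy)} {u : EuclideanSpace ℝ (Fin dx)} (hu : P.IsInnerSolution z u)
    (w : EuclideanSpace ℝ (Fin dy)) :
    P.dualFun z - inner ℝ (P.mulB u) (w - z) ≤ P.dualFun w ∧
    P.dualFun w ≤ P.dualFun z - inner ℝ (P.mulB u) (w - z)
      + P.sigmaMax ^ 2 / μx / 2 * ‖w - z‖ ^ 2 := by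
  have hlow : ∀ w, -inner ℝ w (P.mulB u) - P.primalFun u ≤ P.dualFun w := fun w =>
    (fenchelConj_le_iff hP.f₂_proper w _).1 (hP.coe_dualFun hu w).ge u
      (hP.growth_of_isInnerSolution hu).1
  have hup : ∀ w, P.dualFun w ≤
      -inner ℝ w (P.mulB u) - P.primalFun u + P.sigmaMax ^ 2 / μx / 2 * ‖w - z‖ ^ 2 := by
    intro w
    have h := hP.fenchelConj_le hu w
    rw [← hP.coe_dualFun hu w] at h
    exact_mod_cast h
  have hz := hup z
  simp only [sub_self, norm_zero, ne_eq, OfNat.ofNat_ne_zero, not_false_eq_true, zero_pow,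
    mul_zero, add_zero] at hz
  have h1 := hlow w
  have h2 := hup w
  have h3 := hlow z
  rw [inner_sub_right, real_inner_comm w, real_inner_comm z]
  constructor <;> linarith

theorem BasicAssumption.phi_eq (hP : P.BasicAssumption μx Lx Ly)
    {z : EuclideanSpace ℝ (Fin dy)} {u : EuclideanSpace ℝ (Fin dx)} (hu : P.IsInnerSolution z u)
    (w : EuclideanSpace ℝ (Fin dy)) : P.phi w = ((P.g₁ w + P.dualFun w : ℝ) : EReal) := by
  rw [phi, EReal.coe_add, hP.coe_dualFun hu]

theorem BasicAssumption.phi_upper (hP : P.BasicAssumption μx Lx Ly)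
    {z : EuclideanSpace ℝ (Fin dy)} {u : EuclideanSpace ℝ (Fin dx)} (hu : P.IsInnerSolution z u)
    (w : EuclideanSpace ℝ (Fin dy)) :
    P.g₁ w + P.dualFun w ≤ P.g₁ z + P.dualFun z
      + inner ℝ (gradient P.g₁ z - P.mulB u) (w - z) + P.Lphi μx Ly / 2 * ‖w - z‖ ^ 2 := by
  have h1 := (hP.dualFun_bounds hu w).2
  have h2 := hP.g₁_smooth.le_add_inner_add_sq_norm z w
  rw [inner_sub_left, Lphi]
  linarith

theorem BasicAssumption.phi_lower (hP : P.BasicAssumption μx Lx Ly) {μφ : ℝ}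
    (hφ : EStrongConvex μφ P.phi)
    {z : EuclideanSpace ℝ (Fin dy)} {u : EuclideanSpace ℝ (Fin dx)} (hu : P.IsInnerSolution z u)
    (w : EuclideanSpace ℝ (Fin dy)) :
    P.g₁ z + P.dualFun z + inner ℝ (gradient P.g₁ z - P.mulB u) (w - z) + μφ / 2 * ‖w - z‖ ^ 2 ≤
      P.g₁ w + P.dualFun w := by
  refine (hφ.strongConvexOn (hP.phi_eq hu)).add_inner_add_sq_norm_le (Set.mem_univ z)
    (Set.mem_univ w) fun v _ => ?_
  have h1 := (hP.dualFun_bounds hu v).1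
  have h2 := hP.g₁_convex.add_inner_gradient_le hP.g₁_smooth.1 z v
  rw [inner_sub_left]
  linarith

/-- Comparison of the two quadratic bounds on `φ`; this fails in dimension zero, where every `μφ` is
admissible. -/
theorem BasicAssumption.le_Lphi [Nontrivial (EuclideanSpace ℝ (Fin dy))]
    (hP : P.BasicAssumption μx Lx Ly) {μφ : ℝ} (hφ : EStrongConvex μφ P.phi)
    {z : EuclideanSpace ℝ (Fin dy)} {u : EuclideanSpace ℝ (Fin dx)} (hu : P.IsInnerSolution z u) :
    μφ ≤ P.Lphi μx Ly := by
  obtain ⟨w, hw⟩ := exists_ne z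
  have h1 := hP.phi_lower hφ hu w
  have h2 := hP.phi_upper hu w
  have h3 : 0 < ‖w - z‖ ^ 2 := by
    have := norm_pos_iff.2 (sub_ne_zero.2 hw)
    positivity
  have h4 : μφ * ‖w - z‖ ^ 2 ≤ P.Lphi μx Ly * ‖w - z‖ ^ 2 := by linarith
  exact le_of_mul_le_mul_right h4 h3

/-! ### Saddle points -/

theorem lagr_eq_coe (hf : IsProperFun P.f₂) (hg : IsProperFun P.g₂)
    {x : EuclideanSpace ℝ (Fin dx)} {y : EuclideanSpace ℝ (Fin dy)}
    (hx : P.f₂ x ≠ ⊤) (hy : P.g₂ y ≠ ⊤) :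
    P.lagr x y = ((P.primalFun x + inner ℝ y (P.mulB x) - P.g₁ y - (P.g₂ y).toReal : ℝ) :
      EReal) := by
  rw [lagr, ← hf.coe_toReal hx, ← hg.coe_toReal hy, primalFun]
  simp only [EReal.toReal_coe]
  norm_cast

theorem lagr_eq_top (hg : IsProperFun P.g₂)
    {x : EuclideanSpace ℝ (Fin dx)} {y : EuclideanSpace ℝ (Fin dy)}
    (hx : P.f₂ x = ⊤) (hy : P.g₂ y ≠ ⊤) : P.lagr x y = ⊤ := by
  rw [lagr, ← hg.coe_toReal hy, hx]
  simp

theorem lagr_eq_bot (P : MinimaxProblem dx dy)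
    (x : EuclideanSpace ℝ (Fin dx)) {y : EuclideanSpace ℝ (Fin dy)}
    (hy : P.g₂ y = ⊤) : P.lagr x y = ⊥ := by
  rw [lagr, hy]
  simp

theorem IsSolution.finite {xs : EuclideanSpace ℝ (Fin dx)} {ys : EuclideanSpace ℝ (Fin dy)}
    (h : P.IsSolution xs ys) (hf : IsProperFun P.f₂) (hg : IsProperFun P.g₂) :
    P.f₂ xs ≠ ⊤ ∧ P.g₂ ys ≠ ⊤ := by
  obtain ⟨x₀, hx₀⟩ := hf.2
  obtain ⟨y₀, hy₀⟩ := hg.2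
  have h0 := h x₀ (Set.mem_univ _) y₀ (Set.mem_univ _)
  constructor
  · intro hx
    rw [lagr_eq_top hg hx hy₀] at h0
    by_cases hy : P.g₂ ys = ⊤
    · rw [P.lagr_eq_bot x₀ hy] at h0
      simp at h0
    · rw [lagr_eq_coe hf hg hx₀ hy] at h0
      exact EReal.coe_ne_top _ (top_le_iff.1 h0)
  · intro hy
    rw [P.lagr_eq_bot x₀ hy] at h0
    by_cases hx : P.f₂ xs = ⊤
    · rw [lagr_eq_top hg hx hy₀] at h0
      simp at h0
    · rw [lagr_eq_coe hf hg hx hy₀] at h0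
      exact EReal.coe_ne_bot _ (le_bot_iff.1 h0)

theorem IsSolution.isInnerSolution {xs : EuclideanSpace ℝ (Fin dx)}
    {ys : EuclideanSpace ℝ (Fin dy)} (h : P.IsSolution xs ys) (hf : IsProperFun P.f₂)
    (hg : IsProperFun P.g₂) : P.IsInnerSolution ys xs := by
  obtain ⟨hxs, hys⟩ := h.finite hf hg
  refine isMinOn_iff.2 fun x _ => ?_
  by_cases hx : P.f₂ x = ⊤
  · simp [hx]
  have h1 := h x (Set.mem_univ _) ys (Set.mem_univ _)
  rw [lagr_eq_coe hf hg hxs hys, lagr_eq_coe hf hg hx hys, EReal.coe_le_coe_iff] at h1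
  rw [← hf.coe_toReal hx, ← hf.coe_toReal hxs, inner_mulBT, inner_mulBT]
  simp only [primalFun] at h1
  norm_cast
  linarith

/-- The dual part of a saddle point minimizes `φ + g₂`. -/
theorem IsSolution.isMinOn_dual (hP : P.BasicAssumption μx Lx Ly)
    {xs : EuclideanSpace ℝ (Fin dx)} {ys : EuclideanSpace ℝ (Fin dy)} (h : P.IsSolution xs ys) :
    IsMinOn (fun y => P.g₁ y + P.dualFun y + (P.g₂ y).toReal) {y | P.g₂ y ≠ ⊤} ys := by
  have hf := hP.f₂_proper
  have hg := hP.g₂_proper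
  obtain ⟨hxs, hys⟩ := h.finite hf hg
  refine isMinOn_iff.2 fun y hy => ?_
  have h1 := h xs (Set.mem_univ _) y (Set.mem_univ _)
  rw [lagr_eq_coe hf hg hxs hys, lagr_eq_coe hf hg hxs hy, EReal.coe_le_coe_iff] at h1
  have h2 := (hP.dualFun_bounds (h.isInnerSolution hf hg) y).1
  rw [inner_sub_right, real_inner_comm y, real_inner_comm ys] at h2
  linarith

theorem kappaPhi_eq (hμx : μx ≠ 0) (μφ : ℝ) : P.kappaPhi μx Ly μφ = P.Lphi μx Ly / μφ := by
  rw [kappaPhi, Lphi]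
  field_simp
  ring

end MinimaxProblem

/-! ### Asymptotics of the iterates -/

/-- Passage from a bound on `‖y k - ys‖` for positive `k` by a slowly varying sequence `b` to the
asymptotics of `y` and `x`. Only positive indices are used for `y`, since `y 0` is arbitrary; the
extrapolated point `z k` involves `y (k - 1)`, which is why `b` may not grow too fast backwards. -/
theorem iterates_isBigO {E F : Type*} [NormedAddCommGroup E] [InnerProductSpace ℝ E]
    [NormedAddCommGroup F] {x : ℕ → F} {y z : ℕ → E} {xs : F} {ys : E} {β c K t M N : ℝ}
    {b : ℕ → ℝ} (hβ : |β| ≤ 1) (hc : 0 < c) (hN : 0 ≤ N)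
    (hb : ∀ k, 0 ≤ b k) (hcb : ∀ k, c * b k ≤ b (k + 1)) (ht : 0 ≤ t)
    (htb : ∀ k, t ^ (k + 1) ≤ b (k + 1))
    (hy : ∀ k, ‖y (k + 1) - ys‖ ≤ K * b (k + 1))
    (hz : ∀ k, z (k + 1) = y (k + 1) + β • (y (k + 1) - y k))
    (hx : ∀ k, ‖x (k + 1) - xs‖ ^ 2 ≤ M * (t ^ k) ^ 2 + N * ‖z k - ys‖ ^ 2) :
    (fun k : ℕ => ‖x (k + 1) - xs‖ ^ 2) =O[atTop] (fun k => b k ^ 2) ∧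
      (fun k : ℕ => ‖y k - ys‖ ^ 2) =O[atTop] (fun k => b k ^ 2) := by
  have hy' : ∀ k, ‖y (k + 1) - ys‖ ≤ |K| * b (k + 1) := fun k =>
    (hy k).trans (mul_le_mul_of_nonneg_right (le_abs_self K) (hb _))
  constructor
  · refine IsBigO.of_bound (|M| + N * (|K| * (2 + 1 / c)) ^ 2) ?_
    filter_upwards [eventually_ge_atTop 2] with n hn
    obtain ⟨k, rfl⟩ : ∃ k, n = k + 1 + 1 := ⟨n - 2, by omega⟩
    have hz' : ‖z (k + 1 + 1) - ys‖ ≤ |K| * (2 + 1 / c) * b (k + 1 + 1) := by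
      have e : z (k + 1 + 1) - ys = (y (k + 1 + 1) - ys)
          + β • ((y (k + 1 + 1) - ys) - (y (k + 1) - ys)) := by
        rw [hz]; module
      have hbk : b (k + 1) ≤ 1 / c * b (k + 1 + 1) := by
        rw [one_div_mul_eq_div, le_div_iff₀ hc, mul_comm]
        exact hcb _
      calc ‖z (k + 1 + 1) - ys‖
          ≤ ‖y (k + 1 + 1) - ys‖ + |β| * (‖y (k + 1 + 1) - ys‖ + ‖y (k + 1) - ys‖) := by
            rw [e]
            refine (norm_add_le _ _).trans ?_
            rw [norm_smul, Real.norm_eq_abs]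
            gcongr
            exact norm_sub_le _ _
        _ ≤ ‖y (k + 1 + 1) - ys‖ + 1 * (‖y (k + 1 + 1) - ys‖ + ‖y (k + 1) - ys‖) := by gcongr
        _ ≤ |K| * b (k + 1 + 1) + 1 * (|K| * b (k + 1 + 1) + |K| * (1 / c * b (k + 1 + 1))) := by
            gcongr
            · exact hy' _
            · exact hy' _
            · exact (hy' _).trans (by gcongr)
        _ = _ := by ring
    rw [Real.norm_of_nonneg (sq_nonneg _), Real.norm_of_nonneg (sq_nonneg _)]
    calc _ ≤ M * (t ^ (k + 1 + 1)) ^ 2 + N * ‖z (k + 1 + 1) - ys‖ ^ 2 := hx _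
      _ ≤ |M| * b (k + 1 + 1) ^ 2 + N * (|K| * (2 + 1 / c) * b (k + 1 + 1)) ^ 2 := by
          gcongr
          · exact le_abs_self M
          · exact htb _
      _ = _ := by ring
  · refine IsBigO.of_bound (|K| ^ 2) ?_
    filter_upwards [eventually_ge_atTop 1] with n hn
    obtain ⟨k, rfl⟩ : ∃ k, n = k + 1 := ⟨n - 1, by omega⟩
    rw [Real.norm_of_nonneg (sq_nonneg _), Real.norm_of_nonneg (sq_nonneg _), ← mul_pow]
    exact pow_le_pow_left₀ (norm_nonneg _) (hy' k) 2

theorem abs_eq_mul_sqrt_pow {ε : ℕ → ℝ} {θ : ℝ} (hθ : 0 ≤ θ)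
    (hε : ∀ k, 1 ≤ k → ε (k + 1) ^ 2 = θ * ε k ^ 2) (k : ℕ) :
    |ε (k + 1)| = |ε 1| * √θ ^ k := by
  induction k with
  | zero => simp
  | succ k ih =>
    rw [← Real.sqrt_sq_eq_abs, hε (k + 1) (by omega), Real.sqrt_mul hθ, Real.sqrt_sq_eq_abs, ih]
    ring

namespace MinimaxProblem

variable {dx dy : ℕ} {P : MinimaxProblem dx dy} {μx Lx Ly μφ : ℝ}

/-- iDAPG is the accelerated proximal gradient method for `φ + g₂`, whose gradient at `z k` is
perturbed by `B (u k - x (k + 1))`, with `u k` the exact solution of the inner problem. -/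
theorem BasicAssumption.iterate_recursion [Nontrivial (EuclideanSpace ℝ (Fin dy))]
    (hP : P.BasicAssumption μx Lx Ly) (hμφ : 0 < μφ) (hφ : EStrongConvex μφ P.phi)
    {xs : EuclideanSpace ℝ (Fin dx)} {ys : EuclideanSpace ℝ (Fin dy)} (hsol : P.IsSolution xs ys)
    {x u : ℕ → EuclideanSpace ℝ (Fin dx)} {y z : ℕ → EuclideanSpace ℝ (Fin dy)} {C t : ℝ}
    (ht : 0 ≤ t) (hC : 0 ≤ C)
    (halg : P.IsIDAPG (P.Lphi μx Ly) μφ x y z) (hu : ∀ k, P.IsInnerSolution (z k) (u k))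
    (he : ∀ k, P.sigmaMax * ‖x (k + 1 + 1) - u (k + 1)‖ ≤ C * t ^ k) :
    ∃ (a : ℕ → ℝ) (C' : ℝ), (∀ k, ‖y (k + 1) - ys‖ ≤ a k) ∧
      ∀ k, a (k + 1) ≤ √(1 - 1 / √(P.kappaPhi μx Ly μφ)) * a k + C' * t ^ k := by
  have hμL := hP.le_Lphi hφ (hu 0)
  have hL : 0 < P.Lphi μx Ly := hμφ.trans_le hμL
  have hprox : ∀ k, P.g₂ (y (k + 1)) ≠ ⊤ ∧ IsMinOn (fun v => (P.g₂ v).toReal +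
      P.Lphi μx Ly / 2 * ‖v - (z k - (1 / P.Lphi μx Ly) •
        ((gradient P.g₁ (z k) - P.mulB (u k)) + P.mulB (u k - x (k + 1))))‖ ^ 2)
      {v | P.g₂ v ≠ ⊤} (y (k + 1)) := by
    intro k
    have h := hP.g₂_proper.isMinOn_toReal (halg.y_step k)
    have e1 : 1 / (2 * (1 / P.Lphi μx Ly)) = P.Lphi μx Ly / 2 := by field_simp
    have e2 : gradient P.g₁ (z k) - P.mulB (x (k + 1)) =
        (gradient P.g₁ (z k) - P.mulB (u k)) + P.mulB (u k - x (k + 1)) := by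
      rw [map_sub]
      abel
    rwa [e1, e2] at h
  rw [kappaPhi_eq hP.μx_pos.ne']
  refine inexact_apg_recursion (D := {v | P.g₂ v ≠ ⊤})
    (φ := fun w => P.g₁ w + P.dualFun w) (G := fun w => (P.g₂ w).toReal)
    (q := fun k => gradient P.g₁ (z k) - P.mulB (u k))
    (e := fun k => P.mulB (u k - x (k + 1))) (z := z)
    hμφ hμL ht hC (hφ.strongConvexOn (hP.phi_eq (hu 0)))
    (hP.g₂_convex.convexOn_toReal hP.g₂_proper) (hsol.finite hP.f₂_proper hP.g₂_proper).2
    (hsol.isMinOn_dual hP) (fun k => (hprox k).1) (fun k => ?_) (fun k => (hprox k).2)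
    (fun k p => hP.phi_upper (hu k) p) (fun k w => hP.phi_lower hφ (hu k) w)
    (fun k => ?_)
  · rw [halg.z_step k, betaPhi, if_pos hμφ]
  · refine (P.norm_mulB_le _).trans ?_
    rw [norm_sub_rev]
    exact he k

end MinimaxProblem

theorem theorem2 {dx dy : ℕ} (P : MinimaxProblem dx dy) (μx Lx Ly μφ θ : ℝ)
    (hP : P.BasicAssumption μx Lx Ly)
    (hμφ : 0 < μφ) (hφ : EStrongConvex μφ P.phi)
    (xs : EuclideanSpace ℝ (Fin dx)) (ys : EuclideanSpace ℝ (Fin dy))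
    (hsol : P.IsSolution xs ys)
    (hθ : θ ∈ Set.Ioo (0 : ℝ) 1)
    (ε : ℕ → ℝ) (hε : ∀ k, 1 ≤ k → ε (k + 1) ^ 2 = θ * ε k ^ 2)
    (x : ℕ → EuclideanSpace ℝ (Fin dx)) (y z : ℕ → EuclideanSpace ℝ (Fin dy))
    (halg : P.IsIDAPG (P.Lphi μx Ly) μφ x y z)
    (herr : P.MeetsErrorCondition ε x z) :
    (θ ≠ 1 - 1 / Real.sqrt (P.kappaPhi μx Ly μφ) →
      (fun k : ℕ => ‖x (k + 1) - xs‖ ^ 2) =O[atTop]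
          (fun k : ℕ => max (1 - 1 / Real.sqrt (P.kappaPhi μx Ly μφ)) θ ^ k) ∧
      (fun k : ℕ => ‖y k - ys‖ ^ 2) =O[atTop]
          (fun k : ℕ => max (1 - 1 / Real.sqrt (P.kappaPhi μx Ly μφ)) θ ^ k)) ∧
    (θ = 1 - 1 / Real.sqrt (P.kappaPhi μx Ly μφ) →
      (fun k : ℕ => ‖x (k + 1) - xs‖ ^ 2) =O[atTop]
          (fun k : ℕ => (k : ℝ) ^ 2 * (1 - 1 / Real.sqrt (P.kappaPhi μx Ly μφ)) ^ k) ∧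
      (fun k : ℕ => ‖y k - ys‖ ^ 2) =O[atTop]
          (fun k : ℕ => (k : ℝ) ^ 2 * (1 - 1 / Real.sqrt (P.kappaPhi μx Ly μφ)) ^ k)) := by
  choose u hu hxu using herr
  have hσ := P.sigmaMax_nonneg
  have hxs := hsol.isInnerSolution hP.f₂_proper hP.g₂_proper
  have hεk := abs_eq_mul_sqrt_pow hθ.1.le hε
  have ht : 0 < √θ := Real.sqrt_pos.2 hθ.1
  -- The inner error is measured against `x^*(z k)`, and `x^*` is `σ_max(B) / μ_x`-Lipschitz.
  have hx : ∀ k, ‖x (k + 1) - xs‖ ^ 2 ≤ 2 * (ε 1 ^ 2 / P.sigmaMax ^ 2) * (√θ ^ k) ^ 2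
      + 2 * (P.sigmaMax / μx) ^ 2 * ‖z k - ys‖ ^ 2 := by
    intro k
    have h1 : ‖x (k + 1) - xs‖ ≤ ‖x (k + 1) - u k‖ + ‖u k - xs‖ :=
      norm_sub_le_norm_sub_add_norm_sub ..
    have h2 := hP.norm_sub_le_of_isInnerSolution (hu k) hxs
    have h3 : ε (k + 1) ^ 2 = ε 1 ^ 2 * (√θ ^ k) ^ 2 := by
      rw [← sq_abs, hεk, mul_pow, sq_abs]
    have h4 := hxu k
    rw [h3, mul_div_right_comm] at h4
    have h5 := pow_le_pow_left₀ (norm_nonneg _) h1 2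
    have h6 := pow_le_pow_left₀ (norm_nonneg _) h2 2
    rw [mul_pow] at h6
    nlinarith [sq_nonneg (‖x (k + 1) - u k‖ - ‖u k - xs‖)]
  rcases subsingleton_or_nontrivial (EuclideanSpace ℝ (Fin dy)) with hsub | hnt
  · -- If `dy = 0`, then `κ_φ` may be below `1`, but all errors vanish because `B = 0`.
    have hσ0 : P.sigmaMax = 0 := by
      have : P.mulB = 0 := LinearMap.ext fun v => Subsingleton.elim _ _
      simp [MinimaxProblem.sigmaMax, this]
    have hx0 : (fun k : ℕ => ‖x (k + 1) - xs‖ ^ 2) = fun _ => 0 := by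
      funext k
      have := hx k
      simp only [hσ0] at this
      exact le_antisymm (by simpa using this) (sq_nonneg _)
    have hy0 : (fun k : ℕ => ‖y k - ys‖ ^ 2) = fun _ => 0 := by
      funext k
      simp [Subsingleton.elim (y k) ys]
    rw [hx0, hy0]
    exact ⟨fun _ => ⟨isBigO_zero _ _, isBigO_zero _ _⟩,
      fun _ => ⟨isBigO_zero _ _, isBigO_zero _ _⟩⟩
  have hκ : 1 ≤ √(P.kappaPhi μx Ly μφ) := by
    rw [MinimaxProblem.kappaPhi_eq hP.μx_pos.ne']
    exact Real.one_le_sqrt.2 ((one_le_div hμφ).2 (hP.le_Lphi hφ (hu 0)))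
  have hρ0 : 0 ≤ 1 - 1 / √(P.kappaPhi μx Ly μφ) := by
    rw [sub_nonneg, div_le_one (by linarith)]
    exact hκ
  -- If `σ_max(B) = 0`, the gradient is exact, and the quotient in `hxu` plays no role.
  have he : ∀ k, P.sigmaMax * ‖x (k + 1 + 1) - u (k + 1)‖ ≤ |ε 1| * √θ * √θ ^ k := by
    intro k
    have h1 : (P.sigmaMax * ‖x (k + 1 + 1) - u (k + 1)‖) ^ 2 ≤ |ε (k + 1 + 1)| ^ 2 := by
      rw [mul_pow, sq_abs]
      rcases hσ.eq_or_lt with h0 | h0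
      · rw [← h0]
        simp only [ne_eq, OfNat.ofNat_ne_zero, not_false_eq_true, zero_pow, zero_mul]
        positivity
      · have := hxu (k + 1)
        rwa [le_div_iff₀ (by positivity), mul_comm] at this
    have h2 := le_of_sq_le_sq h1 (abs_nonneg _)
    rw [hεk, pow_succ] at h2
    linarith
  obtain ⟨a, C', hya, ha⟩ := hP.iterate_recursion hμφ hφ hsol ht.le (by positivity) halg hu he
  have hzk : ∀ k, z (k + 1) = y (k + 1) +
      ((√(P.kappaPhi μx Ly μφ) - 1) / (√(P.kappaPhi μx Ly μφ) + 1)) • (y (k + 1) - y k) := by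
    intro k
    rw [halg.z_step k, MinimaxProblem.betaPhi, if_pos hμφ,
      MinimaxProblem.kappaPhi_eq hP.μx_pos.ne']
  have hβ : |(√(P.kappaPhi μx Ly μφ) - 1) / (√(P.kappaPhi μx Ly μφ) + 1)| ≤ 1 := by
    rw [abs_of_nonneg (div_nonneg (by linarith) (by linarith)), div_le_one (by linarith)]
    linarith
  generalize (√(P.kappaPhi μx Ly μφ) - 1) / (√(P.kappaPhi μx Ly μφ) + 1) = β at hzk hβ
  generalize 1 - 1 / √(P.kappaPhi μx Ly μφ) = ρ at *
  have hN : 0 ≤ 2 * (P.sigmaMax / μx) ^ 2 := by positivity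
  constructor
  · intro hne
    obtain ⟨K, hK⟩ := exists_le_mul_max_pow (Real.sqrt_nonneg ρ) ht.le
      (fun h => hne ((Real.sqrt_inj hθ.1.le hρ0).1 h)) ha
    have hm : 0 < max √ρ √θ := lt_max_of_lt_right ht
    have hsq : ∀ k : ℕ, (max √ρ √θ ^ k) ^ 2 = max ρ θ ^ k := by
      intro k
      rw [← Real.sqrt_monotone.map_max, ← pow_mul, mul_comm k, pow_mul,
        Real.sq_sqrt (hρ0.trans (le_max_left _ _))]
    have := iterates_isBigO (b := fun k => max √ρ √θ ^ k) (K := K / max √ρ √θ) hβ hm hN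
      (fun k => by positivity) (fun k => by rw [pow_succ']) ht.le
      (fun k => pow_le_pow_left₀ ht.le (le_max_right _ _) _)
      (fun k => ((hya k).trans (hK k)).trans_eq (by rw [pow_succ]; field_simp)) hzk hx
    simpa only [hsq] using this
  · intro heq
    rw [← heq] at ha ⊢
    obtain ⟨K, hK⟩ := exists_le_mul_succ_mul_pow ht ha
    have hsq : ∀ k : ℕ, ((k : ℝ) * √θ ^ k) ^ 2 = (k : ℝ) ^ 2 * θ ^ k := by
      intro k
      rw [mul_pow, ← pow_mul, mul_comm k, pow_mul, Real.sq_sqrt hθ.1.le]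
    have := iterates_isBigO (b := fun k : ℕ => (k : ℝ) * √θ ^ k) (K := K / √θ) hβ ht hN
      (fun k => by positivity)
      (fun k => by
        have : 0 < √θ ^ (k + 1) := by positivity
        push_cast
        rw [mul_left_comm, ← pow_succ']
        gcongr
        linarith) ht.le
      (fun k => by
        refine le_mul_of_one_le_left (by positivity) ?_
        push_cast
        linarith [(k.cast_nonneg : (0 : ℝ) ≤ k)])
      (fun k => ((hya k).trans (hK k)).trans_eq (by push_cast; rw [pow_succ]; field_simp)) hzk hx
    simpa only [hsq] using this
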